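/- Let $A$ and $P$ be $n\times n$ symmetric positive definite real matrices (or, more generally, Hermitian positive definite matrices over $\mathbb{R}$ or $\mathbb{C}$), and let $$\mathcal{D}_{\mathrm{LD}}(A,P)=\operatorname{tr}(AP^{-1})-\ln\det(AP^{-1})-n .$$ Let $x$ be the solution of $Ax=b$, let $x_0$ be an arbitrary initial guess, and let $x_k$ be the iterates of the preconditioned conjugate gradient method with $H=P^{-1}$, that is, $r_0=b-Ax_0$, $p_0=Hr_0$ and, for $j=0,1,\dots$, $$\alpha_j=\frac{r_j^*Hr_j}{p_j^*Ap_j},\quad x_{j+1}=x_j+\alpha_jp_j,\quad r_{j+1}=r_j-\alpha_jAp_j,\quad \beta_j=\frac{r_{j+1}^*Hr_{j+1}}{r_j^*Hr_j},\quad p_{j+1}=Hr_{j+1}+\beta_jp_j ,$$ where the iterates stay constant, $x_{j+1}=x_j$, as soon as $r_j=0$. Write $\|v\|_A=(v^*Av)^{1/2}$. Then for every even integer $k\ge 0$ with $$3\,\mathcal{D}_{\mathrm{LD}}(A,P)\le k<n$$ we have $$\|x_k-x\|_A\le\Big(\frac{3\,\mathcal{D}_{\mathrm{LD}}(A,P)}{k}\Big)^{k/2}\|x_0-x\|_A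 ,$$ where for $k=0$ the factor in front of $\|x_0-x\|_A$ is read as $1$. -/

import Mathlib

open scoped ComplexOrder Matrix

/-- The Bregman log determinant divergence `tr (A P⁻¹) - log det (A P⁻¹) - n`. For positive
definite `A` and `P` the trace and the determinant of `A P⁻¹` are real (and positive), so taking
real parts does not change them. -/
noncomputable def bregmanLogDet {𝕜 : Type*} [RCLike 𝕜] {n : ℕ}
    (A P : Matrix (Fin n) (Fin n) 𝕜) : ℝ :=
  RCLike.re (A * P⁻¹).trace - Real.log (RCLike.re (A * P⁻¹).det) - (n : ℝ)

/-- The energy norm `‖v‖_A = (v* A v)^{1/2}`. -/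
noncomputable def energyNorm {𝕜 : Type*} [RCLike 𝕜] {n : ℕ}
    (A : Matrix (Fin n) (Fin n) 𝕜) (v : Fin n → 𝕜) : ℝ :=
  Real.sqrt (RCLike.re (star v ⬝ᵥ (A *ᵥ v)))

/-- The vectors kept by the preconditioned conjugate gradient method: the iterate `x`,
the residual `r` and the search direction `p`. -/
structure PCGState (𝕜 : Type*) (n : ℕ) where
  x : Fin n → 𝕜
  r : Fin n → 𝕜
  p : Fin n → 𝕜

/-- `r₀ = b - A x₀`, `p₀ = H r₀`. -/
def pcgInit {𝕜 : Type*} [RCLike 𝕜] {n : ℕ} (A H : Matrix (Fin n) (Fin n) 𝕜)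
    (b x₀ : Fin n → 𝕜) : PCGState 𝕜 n where
  x := x₀
  r := b - A *ᵥ x₀
  p := H *ᵥ (b - A *ᵥ x₀)

/-- The coefficient `α = (r* H r) / (p* A p)`. -/
noncomputable def pcgAlpha {𝕜 : Type*} [RCLike 𝕜] {n : ℕ} (A H : Matrix (Fin n) (Fin n) 𝕜)
    (s : PCGState 𝕜 n) : 𝕜 :=
  (star s.r ⬝ᵥ (H *ᵥ s.r)) / (star s.p ⬝ᵥ (A *ᵥ s.p))

/-- The next residual `r - α A p`. -/
noncomputable def pcgNextResidual {𝕜 : Type*} [RCLike 𝕜] {n : ℕ}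
    (A H : Matrix (Fin n) (Fin n) 𝕜) (s : PCGState 𝕜 n) : Fin n → 𝕜 :=
  s.r - pcgAlpha A H s • (A *ᵥ s.p)

/-- The coefficient `β = (r'* H r') / (r* H r)`, where `r'` is the next residual. -/
noncomputable def pcgBeta {𝕜 : Type*} [RCLike 𝕜] {n : ℕ} (A H : Matrix (Fin n) (Fin n) 𝕜)
    (s : PCGState 𝕜 n) : 𝕜 :=
  (star (pcgNextResidual A H s) ⬝ᵥ (H *ᵥ pcgNextResidual A H s)) / (star s.r ⬝ᵥ (H *ᵥ s.r))

/-- One step of the preconditioned conjugate gradient method. If the residual is zero, the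
system is already solved; the coefficients are then `0 / 0 = 0` and the step keeps the iterate. -/
noncomputable def pcgStep {𝕜 : Type*} [RCLike 𝕜] {n : ℕ} (A H : Matrix (Fin n) (Fin n) 𝕜)
    (s : PCGState 𝕜 n) : PCGState 𝕜 n where
  x := s.x + pcgAlpha A H s • s.p
  r := pcgNextResidual A H s
  p := H *ᵥ pcgNextResidual A H s + pcgBeta A H s • s.p

/-- The states of the preconditioned conjugate gradient method for `A x = b` with the
preconditioner `P` (so `H = P⁻¹`), started at `x₀`. -/
noncomputable def pcg {𝕜 : Type*} [RCLike 𝕜] {n : ℕ} (A P : Matrix (Fin n) (Fin n) 𝕜)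
    (b x₀ : Fin n → 𝕜) : ℕ → PCGState 𝕜 n
  | 0 => pcgInit A P⁻¹ b x₀
  | k + 1 => pcgStep A P⁻¹ (pcg A P b x₀ k)

/-!
The error of the conjugate gradient method after `k` steps is minimal among all errors `q(T) e₀`
with `q` a polynomial of degree at most `k` and `q(0) = 1`. So one polynomial that is small on the
spectrum of the preconditioned operator is enough.

Factor `A = Bᴴ B`. The map `B` carries the energy norm to the Euclidean norm and the preconditioned
matrix `P⁻¹ A` to the Hermitian positive definite matrix `B P⁻¹ Bᴴ`, with eigenvalues
`λ₁ ≥ … ≥ λₙ > 0`. In terms of them the divergence is `D = ∑ (λⱼ - 1 - log λⱼ)`, a sum of nonnegative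
terms (`sum_eigenvalues_eq_bregmanLogDet`). The errors and search directions satisfy the abstract
recurrence `IsConjGrad` (`isConjGrad_pcg`), for which optimality is `IsConjGrad.norm_error_le`.

For `k = 2 m` let `q` vanish at the `m` largest eigenvalues `aᵢ` and the `m` smallest `bᵢ`. On the
remaining spectrum, which lies between `bᵢ` and `aᵢ` for every `i`, the quadratic factor
`(1 - λ / aᵢ) (1 - λ / bᵢ)` is bounded by `sᵢ = (aᵢ - bᵢ)² / (4 aᵢ bᵢ)`. Since `1 + sᵢ` is the squared
ratio of the arithmetic and the geometric mean of `aᵢ` and `bᵢ`, the terms of `D` belonging to `aᵢ`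
and `bᵢ` add up to at least `log (1 + sᵢ)`, whence `∑ log (1 + sᵢ) ≤ D`. Superadditivity of the
geometric mean then gives `∏ sᵢ ≤ (exp (D / m) - 1) ^ m`, and `exp t - 1 ≤ 3 t / 2` for
`0 ≤ t ≤ 2 / 3` turns this into `(3 D / k) ^ (k / 2)` (`exists_polynomial_abs_eval_le`).
-/

/-! ### Scalar inequalities and the polynomial -/

/-- The chord of the exponential over `[0, 2 / 3]`, rounded up to slope `3 / 2`; this is the source
of the constant `3` in the error bound. -/
theorem exp_le_one_add_three_halves_mul {x : ℝ} (h0 : 0 ≤ x) (h1 : x ≤ 2 / 3) :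
    Real.exp x ≤ 1 + 3 / 2 * x := by
  have h2 : Real.exp (2 / 3) ≤ 2 := by
    rw [← Real.le_log_iff_exp_le two_pos]
    linarith [Real.log_two_gt_d9]
  have h := convexOn_exp.2 (Set.mem_univ 0) (Set.mem_univ (2 / 3))
    (show 0 ≤ 1 - 3 / 2 * x by linarith) (show 0 ≤ 3 / 2 * x by linarith) (by ring)
  simp only [smul_eq_mul, mul_zero, zero_add, Real.exp_zero] at h
  rw [show 3 / 2 * x * (2 / 3) = x by ring] at h
  nlinarith

/-- Superadditivity of the geometric mean: `(∏ sᵢ)^{1/m} + 1 ≤ (∏ (1 + sᵢ))^{1/m}`. -/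
theorem one_add_rpow_prod_le {m : ℕ} (hm : 0 < m) (s : Fin m → ℝ) (hs : ∀ i, 0 ≤ s i) :
    1 + (∏ i, s i) ^ (m : ℝ)⁻¹ ≤ (∏ i, (1 + s i)) ^ (m : ℝ)⁻¹ := by
  have hm' : (m : ℝ) ≠ 0 := by positivity
  have ht : ∀ i, 0 < 1 + s i := fun i => by linarith [hs i]
  have hT : 0 < ∏ i, (1 + s i) := Finset.prod_pos fun i _ => ht i
  have hw : ∑ _i : Fin m, (m : ℝ)⁻¹ = 1 := by simp [hm']
  -- the arithmetic-geometric mean inequality for `1 / (1 + sᵢ)` and for `sᵢ / (1 + sᵢ)`, whose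
  -- arithmetic means add up to `1`
  have h1 := Real.geom_mean_le_arith_mean_weighted Finset.univ (fun _ => (m : ℝ)⁻¹)
    (fun i => 1 / (1 + s i)) (fun _ _ => by positivity) hw (fun i _ => by have := ht i; positivity)
  have h2 := Real.geom_mean_le_arith_mean_weighted Finset.univ (fun _ => (m : ℝ)⁻¹)
    (fun i => s i / (1 + s i)) (fun _ _ => by positivity) hw
    (fun i _ => div_nonneg (hs i) (ht i).le)
  rw [Real.finsetProd_rpow _ _ (fun i _ => by have := ht i; positivity)] at h1
  rw [Real.finsetProd_rpow _ _ (fun i _ => div_nonneg (hs i) (ht i).le)] at h2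
  rw [Finset.prod_div_distrib, Real.div_rpow (by simp) hT.le, Finset.prod_const_one,
    Real.one_rpow] at h1
  rw [Finset.prod_div_distrib, Real.div_rpow (Finset.prod_nonneg fun i _ => hs i) hT.le] at h2
  have h3 : ∑ i, (m : ℝ)⁻¹ * (1 / (1 + s i)) + ∑ i, (m : ℝ)⁻¹ * (s i / (1 + s i)) = 1 := by
    rw [← Finset.sum_add_distrib]
    refine (Finset.sum_congr rfl fun i _ => ?_).trans hw
    rw [← mul_add, ← add_div, div_self (ht i).ne', mul_one]
  have h4 := add_le_add h1 h2
  rw [h3, ← add_div, div_le_one (Real.rpow_pos_of_pos hT _)] at h4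
  exact h4

/-- Among nonnegative numbers with `∏ (1 + sᵢ) ≤ exp D` the product `∏ sᵢ` is at most
`(exp (D / m) - 1)^m`, which the chord bound for the exponential turns into a power of `D`. -/
theorem prod_le_of_sum_log_le {m : ℕ} (hm : 0 < m) (s : Fin m → ℝ) (hs : ∀ i, 0 ≤ s i) {D : ℝ}
    (hD : ∑ i, Real.log (1 + s i) ≤ D) (hDm : 3 * D ≤ 2 * m) :
    ∏ i, s i ≤ (3 * D / (2 * m)) ^ m := by
  have hm' : (0 : ℝ) < m := by positivity
  have ht : ∀ i, 0 < 1 + s i := fun i => by linarith [hs i]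
  have hT : 0 < ∏ i, (1 + s i) := Finset.prod_pos fun i _ => ht i
  have hD0 : 0 ≤ D :=
    (Finset.sum_nonneg fun i _ => Real.log_nonneg (by linarith [hs i])).trans hD
  have hle : ∏ i, (1 + s i) ≤ Real.exp D := by
    rw [← Real.log_le_iff_le_exp hT, Real.log_prod fun i _ => (ht i).ne']
    exact hD
  have h1 := Real.rpow_le_rpow hT.le hle (show (0 : ℝ) ≤ (m : ℝ)⁻¹ by positivity)
  rw [← Real.exp_mul] at h1
  have h2 := exp_le_one_add_three_halves_mul (x := D * (m : ℝ)⁻¹) (by positivity) (by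
    rw [← div_eq_mul_inv, div_le_iff₀ hm']; linarith)
  have h3 := one_add_rpow_prod_le hm s hs
  have h4 : (∏ i, s i) ^ (m : ℝ)⁻¹ ≤ 3 * D / (2 * m) := by
    have : 3 * D / (2 * m) = 3 / 2 * (D * (m : ℝ)⁻¹) := by field_simp
    linarith
  have hS : 0 ≤ ∏ i, s i := Finset.prod_nonneg fun i _ => hs i
  calc ∏ i, s i = ((∏ i, s i) ^ (m : ℝ)⁻¹) ^ m := (Real.rpow_inv_natCast_pow hS hm.ne').symm
    _ ≤ _ := pow_le_pow_left₀ (Real.rpow_nonneg hS _) h4 m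

/-- The quadratic with value `1` at `0` and roots `b ≤ a` is extremal on `[b, a]` at the
midpoint. -/
theorem abs_one_sub_div_mul_one_sub_div_le {a b l : ℝ} (hb : 0 < b) (hbl : b ≤ l) (hla : l ≤ a) :
    |(1 - l / a) * (1 - l / b)| ≤ (a - b) ^ 2 / (4 * (a * b)) := by
  have ha : 0 < a := by linarith
  have h : (1 - l / a) * (1 - l / b) = -((a - l) * (l - b) / (a * b)) := by
    field_simp; ring
  rw [h, abs_neg, abs_of_nonneg (div_nonneg (mul_nonneg (by linarith) (by linarith))
    (by positivity)), div_le_div_iff₀ (by positivity) (by positivity)]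
  have : 0 < a * b := by positivity
  nlinarith [mul_nonneg this.le (sq_nonneg (a + b - 2 * l))]

/-- `1 + (a - b)² / (4 a b)` is the squared ratio of the arithmetic to the geometric mean of `a` and
`b`, and `log` of the arithmetic mean is at most `(a + b) / 2 - 1`. -/
theorem log_one_add_sq_sub_div_le {a b : ℝ} (ha : 0 < a) (hb : 0 < b) :
    Real.log (1 + (a - b) ^ 2 / (4 * (a * b))) ≤
      (a - 1 - Real.log a) + (b - 1 - Real.log b) := by
  have h : 1 + (a - b) ^ 2 / (4 * (a * b)) = ((a + b) / 2) ^ 2 / (a * b) := by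
    field_simp; ring
  rw [h, Real.log_div (by positivity) (by positivity), Real.log_pow,
    Real.log_mul ha.ne' hb.ne']
  have := Real.log_le_sub_one_of_pos (show 0 < (a + b) / 2 by positivity)
  push_cast
  linarith

/-- Pairing the `i`-th largest with the `i`-th smallest entry, the extremal values
`sᵢ = (aᵢ - bᵢ)² / (4 aᵢ bᵢ)` satisfy `∑ log (1 + sᵢ) ≤ ∑ (λⱼ - 1 - log λⱼ)`. -/
theorem sum_log_one_add_pair_le {n m : ℕ} (hmn : 2 * m < n) (lam : Fin n → ℝ)
    (hpos : ∀ i, 0 < lam i) (hm : m ≤ n) :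
    ∑ i : Fin m, Real.log (1 + (lam (i.castLE hm) - lam (i.castLE hm).rev) ^ 2 /
        (4 * (lam (i.castLE hm) * lam (i.castLE hm).rev))) ≤
      ∑ j, (lam j - 1 - Real.log (lam j)) := by
  have hinj : Function.Injective
      (Sum.elim (fun i : Fin m => i.castLE hm) (fun i : Fin m => (i.castLE hm).rev)) := by
    rintro (i | i) (j | j) h <;>
      simp only [Sum.elim_inl, Sum.elim_inr, Fin.ext_iff, Fin.val_castLE, Fin.val_rev,
        Sum.inl.injEq, Sum.inr.injEq, reduceCtorEq] at h ⊢ <;> omega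
  calc _ ≤ ∑ i : Fin m, ((lam (i.castLE hm) - 1 - Real.log (lam (i.castLE hm))) +
          (lam (i.castLE hm).rev - 1 - Real.log (lam (i.castLE hm).rev))) :=
        Finset.sum_le_sum fun i _ => log_one_add_sq_sub_div_le (hpos _) (hpos _)
    _ = ∑ c : Fin m ⊕ Fin m, (fun j => lam j - 1 - Real.log (lam j))
          (Sum.elim (fun i : Fin m => i.castLE hm) (fun i : Fin m => (i.castLE hm).rev) c) := by
        rw [Fintype.sum_sum_type, Finset.sum_add_distrib]
        rfl
    _ = ∑ j ∈ Finset.univ.map ⟨_, hinj⟩, (lam j - 1 - Real.log (lam j)) := by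
        rw [Finset.sum_map]
        rfl
    _ ≤ _ := Finset.sum_le_univ_sum_of_nonneg fun j => by
        linarith [Real.log_le_sub_one_of_pos (hpos j)]

open Polynomial in
/-- The polynomial that makes the error bound: normalized at `0`, of degree at most `2 * m`, and
small on all the `λⱼ` because it vanishes at the `m` largest and the `m` smallest of them. -/
theorem exists_polynomial_abs_eval_le {n m : ℕ} (hm0 : 0 < m) (hmn : 2 * m < n) (lam : Fin n → ℝ)
    (hanti : Antitone lam) (hpos : ∀ i, 0 < lam i) {D : ℝ}
    (hD : ∑ j, (lam j - 1 - Real.log (lam j)) ≤ D) (hDm : 3 * D ≤ 2 * m) :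
    ∃ q : ℝ[X], q.natDegree ≤ 2 * m ∧ q.eval 0 = 1 ∧
      ∀ j, |q.eval (lam j)| ≤ (3 * D / (2 * m)) ^ m := by
  have hm : m ≤ n := by omega
  let a : Fin m → ℝ := fun i => lam (i.castLE hm)
  let b : Fin m → ℝ := fun i => lam (i.castLE hm).rev
  have ha : ∀ i, 0 < a i := fun i => hpos _
  have hb : ∀ i, 0 < b i := fun i => hpos _
  have hs : ∀ i, 0 ≤ (a i - b i) ^ 2 / (4 * (a i * b i)) := fun i =>
    div_nonneg (sq_nonneg _) (by have := ha i; have := hb i; positivity)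
  have hprod := prod_le_of_sum_log_le hm0 _ hs
    ((sum_log_one_add_pair_le hmn lam hpos hm).trans hD) hDm
  let q : ℝ[X] := ∏ i, ((1 - C (a i)⁻¹ * X) * (1 - C (b i)⁻¹ * X))
  have heval : ∀ x, q.eval x = ∏ i, ((1 - x / a i) * (1 - x / b i)) := fun x => by
    simp [q, eval_prod, div_eq_inv_mul]
  refine ⟨q, ?_, ?_, fun j => ?_⟩
  · have hlin : ∀ c : ℝ, (1 - C c * X : ℝ[X]).natDegree ≤ 1 := fun c => by compute_degree
    refine (natDegree_prod_le _ _).trans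
      ((Finset.sum_le_card_nsmul _ _ 2 fun i _ => ?_).trans (by simp [mul_comm]))
    exact natDegree_mul_le.trans (add_le_add (hlin _) (hlin _))
  · simp [heval]
  · rw [heval]
    have hnn := (Finset.prod_nonneg fun i _ => hs i).trans hprod
    -- `j` indexes one of the `m` largest values, one of the `m` smallest, or a value between
    -- all the pairs
    rcases lt_or_ge j.val m with h | h
    · rw [Finset.prod_eq_zero (Finset.mem_univ ⟨j, h⟩), abs_zero]
      · exact hnn
      · have : a ⟨j, h⟩ = lam j := rfl
        rw [this, div_self (hpos j).ne']; simp
    rcases lt_or_ge (n - 1 - j.val) m with h' | h'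
    · rw [Finset.prod_eq_zero (Finset.mem_univ ⟨n - 1 - j, h'⟩), abs_zero]
      · exact hnn
      · have : b ⟨n - 1 - j, h'⟩ = lam j := by
          refine congrArg lam (Fin.ext ?_)
          simp only [Fin.val_rev, Fin.val_castLE]; omega
        rw [this, div_self (hpos j).ne']; simp
    · rw [Finset.abs_prod]
      refine (Finset.prod_le_prod (fun _ _ => abs_nonneg _) fun i _ => ?_).trans hprod
      refine abs_one_sub_div_mul_one_sub_div_le (hb i) (hanti ?_) (hanti ?_)
      · rw [Fin.le_def, Fin.val_rev, Fin.val_castLE]; omega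
      · rw [Fin.le_def, Fin.val_castLE]; omega

/-! ### Optimality of the conjugate gradient method -/

section ConjGrad

variable {𝕜 E : Type*} [RCLike 𝕜] [NormedAddCommGroup E] [InnerProductSpace 𝕜 E]

/-- The conjugate gradient recurrence in terms of the errors `e j` and the search directions `p j`.
Here `T` is the preconditioned operator, and the inner product of `E` plays the role of the energy
inner product, so that `⟪e j, T (e j)⟫` stands for `r* H r` and `⟪p j, p j⟫` for `p* A p`. Divisions by zero take
the value `0`, so the sequence stops once an error vanishes. -/
structure IsConjGrad (T : E →ₗ[𝕜] E) (e p : ℕ → E) : Prop where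
  dir_zero : p 0 = T (e 0)
  error_succ (j : ℕ) :
    e (j + 1) = e j - (inner 𝕜 (e j) (T (e j)) / inner 𝕜 (p j) (p j)) • p j
  dir_succ (j : ℕ) :
    p (j + 1) = T (e (j + 1)) +
      (inner 𝕜 (e (j + 1)) (T (e (j + 1))) / inner 𝕜 (e j) (T (e j))) • p j

/-- The span of the first `j` search directions. -/
def dirSpan (𝕜 : Type*) {E : Type*} [RCLike 𝕜] [NormedAddCommGroup E] [InnerProductSpace 𝕜 E]
    (p : ℕ → E) (j : ℕ) : Submodule 𝕜 E :=
  Submodule.span 𝕜 (p '' {i | i < j})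

theorem dirSpan_mono (p : ℕ → E) {i j : ℕ} (h : i ≤ j) : dirSpan 𝕜 p i ≤ dirSpan 𝕜 p j :=
  Submodule.span_mono (Set.image_mono fun _ hl => lt_of_lt_of_le hl h)

theorem dir_mem_dirSpan (p : ℕ → E) {i j : ℕ} (h : i < j) : p i ∈ dirSpan 𝕜 p j :=
  Submodule.subset_span ⟨i, h, rfl⟩

theorem inner_eq_zero_of_mem_dirSpan {p : ℕ → E} {j : ℕ} {v : E}
    (h : ∀ i < j, inner 𝕜 (p i) v = 0) {y : E} (hy : y ∈ dirSpan 𝕜 p j) : inner 𝕜 y v = 0 := by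
  induction hy using Submodule.span_induction with
  | mem y hy => obtain ⟨i, hi, rfl⟩ := hy; exact h i hi
  | zero => exact inner_zero_left _
  | add y z _ _ hy hz => rw [inner_add_left, hy, hz, add_zero]
  | smul c y _ hy => rw [inner_smul_left, hy, mul_zero]

namespace IsConjGrad

variable {T : E →ₗ[𝕜] E} {e p : ℕ → E}

theorem error_eq_zero (h : IsConjGrad T e p) {i j : ℕ} (hij : i ≤ j) (hi : e i = 0) :
    e j = 0 := by
  induction j, hij using Nat.le_induction with
  | base => exact hi
  | succ j _ ih => rw [h.error_succ, ih, inner_zero_left, zero_div, zero_smul, sub_zero]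

theorem apply_error_mem (h : IsConjGrad T e p) (j : ℕ) : T (e j) ∈ dirSpan 𝕜 p (j + 1) := by
  cases j with
  | zero => rw [← h.dir_zero]; exact dir_mem_dirSpan p (by omega)
  | succ j =>
    rw [eq_sub_of_add_eq (h.dir_succ j).symm]
    exact sub_mem (dir_mem_dirSpan p (by omega))
      (Submodule.smul_mem _ _ (dir_mem_dirSpan p (by omega)))

theorem error_zero_sub_mem (h : IsConjGrad T e p) (j : ℕ) : e 0 - e j ∈ dirSpan 𝕜 p j := by
  induction j with
  | zero => rw [sub_self]; exact zero_mem _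
  | succ j ih =>
    rw [h.error_succ, sub_sub_eq_add_sub, add_sub_right_comm]
    exact add_mem (dirSpan_mono p (by omega) ih)
      (Submodule.smul_mem _ _ (dir_mem_dirSpan p (by omega)))

/-- As long as the step length is nonzero, `p j` is a multiple of `e j - e (j + 1)`. -/
theorem apply_dir_mem (h : IsConjGrad T e p) {j : ℕ}
    (hj : inner 𝕜 (e j) (T (e j)) ≠ 0) (hp : p j ≠ 0) : T (p j) ∈ dirSpan 𝕜 p (j + 2) := by
  have hα : inner 𝕜 (e j) (T (e j)) / inner 𝕜 (p j) (p j) ≠ 0 :=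
    div_ne_zero hj (inner_self_ne_zero.mpr hp)
  have hα' : (inner 𝕜 (e j) (T (e j)) / inner 𝕜 (p j) (p j)) • p j = e j - e (j + 1) := by
    rw [h.error_succ, sub_sub_cancel]
  rw [← Submodule.smul_mem_iff _ hα, ← map_smul, hα', map_sub]
  exact sub_mem (dirSpan_mono p (by omega) (h.apply_error_mem j)) (h.apply_error_mem (j + 1))

/-- The orthogonality relations of the conjugate gradient method: the directions are mutually
orthogonal, and each error is orthogonal to all earlier directions. -/
theorem orthogonality (h : IsConjGrad T e p) (hT : T.IsSymmetric)
    (hdef : ∀ v, inner 𝕜 v (T v) = 0 → v = 0) (j : ℕ) :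
    (∀ i < j, inner 𝕜 (p i) (e j) = 0) ∧ (∀ i < j, inner 𝕜 (p i) (p j) = 0) ∧
      inner 𝕜 (p j) (e j) = inner 𝕜 (e j) (T (e j)) := by
  induction j using Nat.strong_induction_on with
  | _ j ih =>
  cases j with
  | zero => simp [h.dir_zero, hT (e 0) (e 0)]
  | succ j =>
    obtain ⟨hpe, hpp, hd⟩ := ih j (by omega)
    have hdir : ∀ i ≤ j, e i ≠ 0 → p i ≠ 0 := fun i hi hei hpi => hei <| hdef _ <| by
      rw [← (ih i (by omega)).2.2, hpi, inner_zero_left]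
    have hpe' : ∀ i < j + 1, inner 𝕜 (p i) (e (j + 1)) = 0 := fun i hi => by
      rw [h.error_succ, inner_sub_right, inner_smul_right]
      rcases Nat.lt_succ_iff_lt_or_eq.mp hi with hi | rfl
      · rw [hpe i hi, hpp i hi, mul_zero, sub_zero]
      · by_cases hp : p i = 0
        · simp [hp]
        · rw [hd, div_mul_cancel₀ _ (inner_self_ne_zero.mpr hp), sub_self]
    refine ⟨hpe', fun i hi => ?_, ?_⟩
    -- for `i < j` move `T` to `p i`, which stays among the earlier directions; for `i = j` the
    -- choice of `β` cancels the inner product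
    · rw [h.dir_succ, inner_add_right, inner_smul_right]
      by_cases hei : e i = 0
      · have h1 : e (j + 1) = 0 := h.error_eq_zero (by omega) hei
        simp [h1]
      have hne : inner 𝕜 (e i) (T (e i)) ≠ 0 := fun h0 => hei (hdef _ h0)
      have hpi := hdir i (by omega) hei
      rcases Nat.lt_succ_iff_lt_or_eq.mp hi with hi | rfl
      · rw [hpp i hi, mul_zero, add_zero, ← hT]
        exact inner_eq_zero_of_mem_dirSpan hpe'
          (dirSpan_mono p (by omega) (h.apply_dir_mem hne hpi))
      · have h1 : inner 𝕜 (e i) (T (e (i + 1))) = 0 := by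
          rw [← hT]; exact inner_eq_zero_of_mem_dirSpan hpe' (h.apply_error_mem i)
        have hpp0 : inner 𝕜 (p i) (p i) ≠ 0 := inner_self_ne_zero.mpr hpi
        -- pair `α • p i = e i - e (i + 1)` with `T (e (i + 1))`; the coefficient `α` is real
        have h2 : inner 𝕜 (e (i + 1)) (T (e (i + 1))) =
            -(inner 𝕜 (e i) (T (e i)) / inner 𝕜 (p i) (p i) * inner 𝕜 (p i) (T (e (i + 1)))) := by
          have hreal : (starRingEnd 𝕜) (inner 𝕜 (e i) (T (e i)) / inner 𝕜 (p i) (p i)) =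
              inner 𝕜 (e i) (T (e i)) / inner 𝕜 (p i) (p i) := by
            rw [map_div₀, inner_conj_symm, inner_conj_symm, hT]
          have h3 := congrArg (fun w => inner 𝕜 w (T (e (i + 1)))) (h.error_succ i)
          simpa only [inner_sub_left, inner_smul_left, hreal, h1, zero_sub] using h3
        rw [h2]
        field_simp
        ring
    · rw [h.dir_succ, inner_add_left, inner_smul_left, hpe' j (by omega), mul_zero, add_zero, hT]

/-- If no breakdown occurs before step `k`, the span of the first `k` directions contains the Krylov
vectors `T (e 0), …, T ^ k (e 0)`, hence `q(T) (e 0) - e 0` for every `q` of degree at most `k` with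
`q(0) = 1`. -/
theorem aeval_apply_sub_mem (h : IsConjGrad T e p) {k : ℕ}
    (hne : ∀ i < k, inner 𝕜 (e i) (T (e i)) ≠ 0) (hp : ∀ i < k, p i ≠ 0)
    {q : Polynomial 𝕜} (hq : q.natDegree ≤ k) (hq0 : q.eval 0 = 1) :
    Polynomial.aeval T q (e 0) - e 0 ∈ dirSpan 𝕜 p k := by
  have hstep : ∀ j < k, ∀ y ∈ dirSpan 𝕜 p j, T y ∈ dirSpan 𝕜 p (j + 1) := by
    intro j hj y hy
    induction hy using Submodule.span_induction with
    | mem y hy =>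
      obtain ⟨i, hi, rfl⟩ := hy
      have hi : i < j := hi
      exact dirSpan_mono p (by omega) (h.apply_dir_mem (hne i (by omega)) (hp i (by omega)))
    | zero => rw [map_zero]; exact zero_mem _
    | add y z _ _ hy hz => rw [map_add]; exact add_mem hy hz
    | smul c y _ hy => rw [map_smul]; exact Submodule.smul_mem _ _ hy
  have hpow : ∀ j, j + 1 ≤ k → (T ^ (j + 1)) (e 0) ∈ dirSpan 𝕜 p (j + 1) := by
    intro j
    induction j with
    | zero => intro _; simpa using h.apply_error_mem 0
    | succ j ih =>
      intro hj
      rw [pow_succ', Module.End.mul_apply]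
      exact hstep _ (by omega) _ (ih (by omega))
  rw [Polynomial.aeval_eq_sum_range' (Nat.lt_succ_of_le hq), Finset.sum_range_succ',
    Polynomial.coeff_zero_eq_eval_zero, hq0, pow_zero, one_smul, LinearMap.add_apply,
    Module.End.one_apply, add_sub_cancel_right, LinearMap.sum_apply]
  refine sum_mem fun i hi => ?_
  rw [Finset.mem_range] at hi
  exact Submodule.smul_mem _ _ (dirSpan_mono p (by omega) (hpow i (by omega)))

/-- Optimality of the conjugate gradient method: the error `e k` is orthogonal to the span of
the first `k` directions, and `q(T) (e 0)` differs from it by an element of that span. -/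
theorem norm_error_le (h : IsConjGrad T e p) (hT : T.IsSymmetric)
    (hdef : ∀ v, inner 𝕜 v (T v) = 0 → v = 0) {k : ℕ}
    {q : Polynomial 𝕜} (hq : q.natDegree ≤ k) (hq0 : q.eval 0 = 1) :
    ‖e k‖ ≤ ‖Polynomial.aeval T q (e 0)‖ := by
  by_cases hk : e k = 0
  · rw [hk, norm_zero]; exact norm_nonneg _
  have he : ∀ i < k, e i ≠ 0 := fun i hi h0 => hk (h.error_eq_zero hi.le h0)
  have hne : ∀ i < k, inner 𝕜 (e i) (T (e i)) ≠ 0 := fun i hi h0 => he i hi (hdef _ h0)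
  have hp : ∀ i < k, p i ≠ 0 := fun i hi hpi => hne i hi <| by
    rw [← (h.orthogonality hT hdef i).2.2, hpi, inner_zero_left]
  have hmem : Polynomial.aeval T q (e 0) - e k ∈ dirSpan 𝕜 p k := by
    rw [← sub_add_sub_cancel _ (e 0)]
    exact add_mem (h.aeval_apply_sub_mem hne hp hq hq0) (h.error_zero_sub_mem k)
  have horth := inner_eq_zero_of_mem_dirSpan (h.orthogonality hT hdef k).1 hmem
  have hpyth := norm_add_sq_eq_norm_sq_add_norm_sq_of_inner_eq_zero _ _ horth
  rw [sub_add_cancel] at hpyth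
  refine le_of_sq_le_sq ?_ (norm_nonneg _)
  nlinarith [sq_nonneg ‖Polynomial.aeval T q (e 0) - e k‖]

end IsConjGrad

/-! ### Polynomials of symmetric operators -/

/-- On an orthonormal eigenbasis `q(T)` acts diagonally, by the values of `q` at the eigenvalues. -/
theorem norm_aeval_apply_le {n : ℕ} [FiniteDimensional 𝕜 E] {T : E →ₗ[𝕜] E} (hT : T.IsSymmetric)
    (hn : Module.finrank 𝕜 E = n) (q : Polynomial ℝ) {C : ℝ}
    (hC : 0 ≤ C) (hq : ∀ j, |q.eval (hT.eigenvalues hn j)| ≤ C) (v : E) :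
    ‖Polynomial.aeval T (q.map (algebraMap ℝ 𝕜)) v‖ ≤ C * ‖v‖ := by
  set b := hT.eigenvectorBasis hn
  have hb : ∀ j, Polynomial.aeval T (q.map (algebraMap ℝ 𝕜)) (b j) =
      ((q.eval (hT.eigenvalues hn j) : ℝ) : 𝕜) • b j := fun j => by
    rw [Module.End.aeval_apply_of_hasEigenvector (hT.hasEigenvector_eigenvectorBasis hn j)]
    congr 1
    exact Polynomial.eval_map_apply _ _
  have hcoord : ∀ j, inner 𝕜 (b j) (Polynomial.aeval T (q.map (algebraMap ℝ 𝕜)) v) =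
      ((q.eval (hT.eigenvalues hn j) : ℝ) : 𝕜) * inner 𝕜 (b j) v := fun j => by
    conv_lhs => rw [← b.sum_repr' v]
    simp only [map_sum, map_smul, hb, inner_sum, inner_smul_right]
    simp [b.inner_eq_ite, mul_comm]
  refine le_of_sq_le_sq ?_ (by positivity)
  rw [mul_pow, ← b.sum_sq_norm_inner_right, ← b.sum_sq_norm_inner_right v, Finset.mul_sum]
  refine Finset.sum_le_sum fun j _ => ?_
  rw [hcoord, norm_mul, mul_pow, RCLike.norm_ofReal]
  exact mul_le_mul_of_nonneg_right (pow_le_pow_left₀ (abs_nonneg _) (hq j) 2) (sq_nonneg _)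

end ConjGrad

/-! ### Transfer to matrices -/

section Matrices

variable {𝕜 : Type*} [RCLike 𝕜] {n : ℕ}

theorem star_dotProduct_conj_mulVec (B H : Matrix (Fin n) (Fin n) 𝕜) (u : Fin n → 𝕜) :
    star u ⬝ᵥ ((B * H * Bᴴ) *ᵥ u) = star (Bᴴ *ᵥ u) ⬝ᵥ (H *ᵥ (Bᴴ *ᵥ u)) := by
  rw [Matrix.star_mulVec, Matrix.conjTranspose_conjTranspose, ← Matrix.dotProduct_mulVec,
    Matrix.mulVec_mulVec, Matrix.mulVec_mulVec, Matrix.mul_assoc]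

theorem star_dotProduct_conjTranspose_mul_self_mulVec (B : Matrix (Fin n) (Fin n) 𝕜)
    (u : Fin n → 𝕜) :
    star u ⬝ᵥ ((Bᴴ * B) *ᵥ u) = star (B *ᵥ u) ⬝ᵥ (B *ᵥ u) := by
  rw [Matrix.star_mulVec, ← Matrix.dotProduct_mulVec, Matrix.mulVec_mulVec]

theorem inner_toLp_eq_star_dotProduct (u v : Fin n → 𝕜) :
    inner 𝕜 (WithLp.toLp 2 u) (WithLp.toLp 2 v) = star u ⬝ᵥ v := by
  rw [EuclideanSpace.inner_toLp_toLp, dotProduct_comm]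

theorem energyNorm_conjTranspose_mul_self (B : Matrix (Fin n) (Fin n) 𝕜) (v : Fin n → 𝕜) :
    energyNorm (Bᴴ * B) v = ‖WithLp.toLp 2 (B *ᵥ v)‖ := by
  rw [energyNorm, star_dotProduct_conjTranspose_mul_self_mulVec, ← inner_toLp_eq_star_dotProduct,
    @norm_eq_sqrt_re_inner 𝕜]

theorem energyNorm_sub_comm (A : Matrix (Fin n) (Fin n) 𝕜) (u v : Fin n → 𝕜) :
    energyNorm A (u - v) = energyNorm A (v - u) := by
  rw [energyNorm, energyNorm, ← neg_sub v u, Matrix.mulVec_neg, star_neg, neg_dotProduct_neg]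

/-- The recursively updated residual is the true residual of the iterate. -/
theorem pcg_residual_eq {A P : Matrix (Fin n) (Fin n) 𝕜} {b x : Fin n → 𝕜} (x₀ : Fin n → 𝕜)
    (hx : A *ᵥ x = b) (j : ℕ) : (pcg A P b x₀ j).r = A *ᵥ (x - (pcg A P b x₀ j).x) := by
  induction j with
  | zero => simp [pcg, pcgInit, Matrix.mulVec_sub, hx]
  | succ j ih =>
    simp only [pcg, pcgStep, pcgNextResidual]
    rw [ih, ← sub_sub, Matrix.mulVec_sub _ (x - _), Matrix.mulVec_smul]

/-- The factorization `A = Bᴴ B` carries the energy inner product to the Euclidean one and the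
preconditioned matrix `P⁻¹ A` to the Hermitian matrix `B P⁻¹ Bᴴ`. -/
theorem isConjGrad_pcg (B P : Matrix (Fin n) (Fin n) 𝕜) {b x : Fin n → 𝕜} (x₀ : Fin n → 𝕜)
    (hx : (Bᴴ * B) *ᵥ x = b) :
    IsConjGrad (𝕜 := 𝕜) (Matrix.toEuclideanLin (B * P⁻¹ * Bᴴ))
      (fun j => WithLp.toLp 2 (B *ᵥ (x - (pcg (Bᴴ * B) P b x₀ j).x)))
      (fun j => WithLp.toLp 2 (B *ᵥ (pcg (Bᴴ * B) P b x₀ j).p)) := by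
  have hr := pcg_residual_eq (P := P) x₀ hx
  have hT : ∀ u : Fin n → 𝕜, Matrix.toEuclideanLin (B * P⁻¹ * Bᴴ) (WithLp.toLp 2 (B *ᵥ u)) =
      WithLp.toLp 2 (B *ᵥ (P⁻¹ *ᵥ ((Bᴴ * B) *ᵥ u))) := fun u => by
    rw [Matrix.toLpLin_toLp, Matrix.toLin'_apply]
    simp only [Matrix.mulVec_mulVec, Matrix.mul_assoc]
  have hrr : ∀ u : Fin n → 𝕜, inner 𝕜 (WithLp.toLp 2 (B *ᵥ u))
      (Matrix.toEuclideanLin (B * P⁻¹ * Bᴴ) (WithLp.toLp 2 (B *ᵥ u))) =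
      star ((Bᴴ * B) *ᵥ u) ⬝ᵥ (P⁻¹ *ᵥ ((Bᴴ * B) *ᵥ u)) := fun u => by
    rw [Matrix.toLpLin_toLp, Matrix.toLin'_apply, inner_toLp_eq_star_dotProduct,
      star_dotProduct_conj_mulVec, Matrix.mulVec_mulVec]
  have hpp : ∀ u : Fin n → 𝕜, inner 𝕜 (WithLp.toLp 2 (B *ᵥ u)) (WithLp.toLp 2 (B *ᵥ u)) =
      star u ⬝ᵥ ((Bᴴ * B) *ᵥ u) := fun u => by
    rw [inner_toLp_eq_star_dotProduct, star_dotProduct_conjTranspose_mul_self_mulVec]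
  refine ⟨?_, fun j => ?_, fun j => ?_⟩
  · rw [hT, ← hr]
    rfl
  · rw [hrr, hpp, ← hr, ← WithLp.toLp_smul, ← WithLp.toLp_sub, ← Matrix.mulVec_smul,
      ← Matrix.mulVec_sub, sub_sub]
    rfl
  · rw [hrr, hT, hrr, ← hr, ← hr, ← WithLp.toLp_smul, ← WithLp.toLp_add, ← Matrix.mulVec_smul,
      ← Matrix.mulVec_add]
    rfl

/-- The divergence of the eigenvalues: `D(A, P) = ∑ (λⱼ - 1 - log λⱼ)`. -/
theorem sum_eigenvalues_eq_bregmanLogDet {B P : Matrix (Fin n) (Fin n) 𝕜}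
    (hT : (Matrix.toEuclideanLin (B * P⁻¹ * Bᴴ)).IsSymmetric)
    (hn : Module.finrank 𝕜 (EuclideanSpace 𝕜 (Fin n)) = n)
    (hpos : ∀ j, 0 < hT.eigenvalues hn j) :
    ∑ j, (hT.eigenvalues hn j - 1 - Real.log (hT.eigenvalues hn j)) =
      bregmanLogDet (Bᴴ * B) P := by
  have htr : RCLike.re (Bᴴ * B * P⁻¹).trace = ∑ j, hT.eigenvalues hn j := by
    rw [← hT.re_trace_eq_sum_eigenvalues hn, Matrix.toEuclideanLin_eq_toLin_orthonormal,
      Matrix.trace_toLin_eq, Matrix.mul_assoc, Matrix.trace_mul_comm Bᴴ]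
  have hdet : RCLike.re (Bᴴ * B * P⁻¹).det = ∏ j, hT.eigenvalues hn j := by
    have h := hT.det_eq_prod_eigenvalues hn
    rw [LinearMap.det_toLpLin] at h
    rw [Matrix.mul_assoc, Matrix.det_mul_comm Bᴴ, h, ← RCLike.ofReal_prod, RCLike.ofReal_re]
  rw [bregmanLogDet, htr, hdet, Real.log_prod fun j _ => (hpos j).ne']
  simp only [Finset.sum_sub_distrib, Finset.sum_const, Finset.card_univ, Fintype.card_fin,
    nsmul_eq_mul, mul_one]
  ring

end Matrices

/-! ### The error bound -/

theorem mainTheorem7 {𝕜 : Type*} [RCLike 𝕜] {n : ℕ}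
    (A P : Matrix (Fin n) (Fin n) 𝕜) (hA : A.PosDef) (hP : P.PosDef)
    (b x x₀ : Fin n → 𝕜) (hx : A *ᵥ x = b)
    (k : ℕ) (hk : Even k) (hDk : 3 * bregmanLogDet A P ≤ (k : ℝ)) (hkn : k < n) :
    energyNorm A ((pcg A P b x₀ k).x - x) ≤
      (3 * bregmanLogDet A P / (k : ℝ)) ^ ((k : ℝ) / 2) * energyNorm A (x₀ - x) := by
  obtain ⟨m, rfl⟩ := hk.two_dvd
  rcases Nat.eq_zero_or_pos m with rfl | hm
  -- for `k = 0` the factor is `(_ / 0) ^ (0 : ℝ) = 1`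
  · simp [pcg, pcgInit]
  obtain ⟨B, rfl⟩ : ∃ B : Matrix (Fin n) (Fin n) 𝕜, A = Bᴴ * B := by
    open scoped MatrixOrder in
    exact CStarAlgebra.nonneg_iff_eq_star_mul_self.mp hA.posSemidef.nonneg
  have hB : IsUnit B := isUnit_of_mul_isUnit_right hA.isUnit
  have hMpos : (B * P⁻¹ * Bᴴ).PosDef :=
    hP.inv.mul_mul_conjTranspose_same (Matrix.vecMul_injective_of_isUnit hB)
  have hT : (Matrix.toEuclideanLin (B * P⁻¹ * Bᴴ)).IsSymmetric :=
    Matrix.isSymmetric_toEuclideanLin_iff.mpr hMpos.1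
  have hTpos : ∀ v : EuclideanSpace 𝕜 (Fin n), v ≠ 0 →
      0 < RCLike.re (inner 𝕜 v (Matrix.toEuclideanLin (B * P⁻¹ * Bᴴ) v)) := fun v hv => by
    have hv' : v.ofLp ≠ 0 := fun h => hv (WithLp.ofLp_injective 2 h)
    have := hMpos.re_dotProduct_pos hv'
    rwa [← inner_toLp_eq_star_dotProduct] at this
  have hdef : ∀ v : EuclideanSpace 𝕜 (Fin n),
      inner 𝕜 v (Matrix.toEuclideanLin (B * P⁻¹ * Bᴴ) v) = 0 → v = 0 := fun v hv => by
    by_contra h0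
    have := hTpos v h0
    rw [hv, map_zero] at this
    exact this.false
  have hn : Module.finrank 𝕜 (EuclideanSpace 𝕜 (Fin n)) = n := finrank_euclideanSpace_fin
  have hpos : ∀ j, 0 < hT.eigenvalues hn j := fun j => by
    have h := hTpos _ (hT.hasEigenvector_eigenvectorBasis hn j).2
    rw [hT.apply_eigenvectorBasis, inner_smul_right, inner_self_eq_norm_sq_to_K,
      (hT.eigenvectorBasis hn).norm_eq_one] at h
    simpa using h
  have hD := sum_eigenvalues_eq_bregmanLogDet hT hn hpos
  have hD0 : 0 ≤ bregmanLogDet (Bᴴ * B) P := by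
    rw [← hD]
    exact Finset.sum_nonneg fun j _ => by linarith [Real.log_le_sub_one_of_pos (hpos j)]
  push_cast at hDk ⊢
  obtain ⟨q, hdeg, hq0, hq⟩ := exists_polynomial_abs_eval_le hm hkn _
    (hT.eigenvalues_antitone hn) hpos hD.le hDk
  have hopt := (isConjGrad_pcg B P x₀ hx).norm_error_le hT hdef (k := 2 * m)
    (q := q.map (algebraMap ℝ 𝕜)) (Polynomial.natDegree_map_le.trans hdeg)
    (by rw [← map_zero (algebraMap ℝ 𝕜), Polynomial.eval_map_apply, hq0, map_one])
  have hbound := norm_aeval_apply_le hT hn q (by positivity) hq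
    (WithLp.toLp 2 (B *ᵥ (x - (pcg (Bᴴ * B) P b x₀ 0).x)))
  rw [mul_div_cancel_left₀ _ two_ne_zero, Real.rpow_natCast, energyNorm_sub_comm,
    energyNorm_sub_comm _ x₀, energyNorm_conjTranspose_mul_self, energyNorm_conjTranspose_mul_self]
  exact hopt.trans hbound
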